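/- Let $\psi(t)=\dfrac{1}{\log(e/t)}$ for $t\in(0,1)$ and $\psi(t)=t$ for $t\ge 1$. For a measurable function $f$ on $\mathbb{R}^d$ such that $\{|f|>n\}$ has finite Lebesgue measure for some $n\in\mathbb{N}$ (write $f\in S(\mathbb{R}^d)$), let $\mu(s,f)=\inf\{r\ge 0:\ |\{|f|>r\}|\le s\}$, $s>0$, be its decreasing rearrangement. The Lorentz space $\Lambda_\psi(\mathbb{R}^d)$ consists of all $f\in S(\mathbb{R}^d)$ with $$\|f\|_{\Lambda_\psi}=\int_0^\infty \mu(s,f)\,d\psi(s)<\infty ,$$ and its $2$-convexification $\Lambda_\psi^{(2)}(\mathbb{R}^d)$ consists of all $f\in S(\mathbb{R}^d)$ with $|f|^2\in\Lambda_\psi(\mathbb{R}^d)$; put $\|f\|_{\Lambda_\psi^{(2)}}=\big\||f|^2\big\|_{\Lambda_\psi}^{1/2}$. Let $(1-\Delta)^{-d/4}$ be the bounded operator on $L_2(\mathbb{R}^d)$ with Fourier symbol $(1+4\pi^2|\xi|^2)^{-d/4}$, where $\hat u(\xi)=\int_{\mathbb{R}^d} e^{-2\pi i\langle y,\xi\rangle}u(y)\,dy$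 (extended unitarily to $L_2(\mathbb{R}^d)$). **Proposition.** For every integer $d\ge 1$ there is a constant $c_d$, depending only on $d$, such that for every complex-valued $x\in L_2(\mathbb{R}^d)$ one has $(1-\Delta)^{-d/4}x\in\Lambda_\psi^{(2)}(\mathbb{R}^d)$ and $$\big\|(1-\Delta)^{-\frac d4}x\big\|_{\Lambda_\psi^{(2)}}\le c_d\,\|x\|_2 .$$ -/

import Mathlib

open MeasureTheory Set Filter Topology
open scoped ENNReal NNReal FourierTransform

noncomputable section

namespace CriticalSobolev

section Rearrangement

variable {Ω E : Type*} [MeasurableSpace Ω] [NormedAddCommGroup E]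

/-- The class `S(Ω, ν)`: (a.e. strongly) `ν`-measurable functions `f` such that, for some natural
number `n`, the set where `|f| > n` has finite measure. -/
def MemS (ν : Measure Ω) (f : Ω → E) : Prop :=
  AEStronglyMeasurable f ν ∧ ∃ n : ℕ, ν {x | (n : ℝ) < ‖f x‖} < ∞

/-- The decreasing rearrangement `μ(s, f) = inf {r ≥ 0 : ν {|f| > r} ≤ s}`, as an extended
nonnegative real. For `f` in `S(Ω, ν)` it is finite at every `s > 0`. -/
def rearrangement (ν : Measure Ω) (f : Ω → E) (s : ℝ) : ℝ≥0∞ :=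
  sInf {r : ℝ≥0∞ | ν {x | r < ‖f x‖ₑ} ≤ ENNReal.ofReal s}

/-- The Lorentz functional `∫_0^∞ μ(s, f) dψ(s)`, a Lebesgue–Stieltjes integral over `(0, ∞)`. -/
def lorentzNorm (ψ : StieltjesFunction ℝ) (ν : Measure Ω) (f : Ω → E) : ℝ≥0∞ :=
  ∫⁻ s in Ioi (0 : ℝ), rearrangement ν f s ∂ψ.measure

/-- Membership in the Lorentz space `Λ_ψ(Ω, ν)`. -/
def MemLorentz (ψ : StieltjesFunction ℝ) (ν : Measure Ω) (f : Ω → E) : Prop :=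
  MemS ν f ∧ lorentzNorm ψ ν f < ∞

/-- Membership in the 2-convexification `Λ_ψ^{(2)}(Ω, ν)`: `f ∈ S(Ω, ν)` and `|f|² ∈ Λ_ψ`. -/
def MemLorentzTwo (ψ : StieltjesFunction ℝ) (ν : Measure Ω) (f : Ω → E) : Prop :=
  MemS ν f ∧ MemLorentz ψ ν (fun x => ‖f x‖ ^ 2)

/-- The functional `‖f‖ = ‖ |f|² ‖_{Λ_ψ}^{1/2}` of the 2-convexification `Λ_ψ^{(2)}(Ω, ν)`. -/
def lorentzTwoNorm (ψ : StieltjesFunction ℝ) (ν : Measure Ω) (f : Ω → E) : ℝ≥0∞ :=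
  (lorentzNorm ψ ν (fun x => ‖f x‖ ^ 2)) ^ (1 / 2 : ℝ)

end Rearrangement

section Weight

/-- `ψ(t) = 1 / log(e / t)` for `0 < t < 1` and `ψ(t) = t` for `t ≥ 1`, continued by `0` to
`t ≤ 0` (it tends to `0` at `0+`). -/
def psiFun (t : ℝ) : ℝ :=
  if t ≤ 0 then 0 else if t < 1 then 1 / Real.log (Real.exp 1 / t) else t

lemma log_e_div {t : ℝ} (ht : 0 < t) : Real.log (Real.exp 1 / t) = 1 - Real.log t := by
  rw [Real.log_div (Real.exp_pos 1).ne' ht.ne', Real.log_exp]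

lemma psiFun_of_nonpos {t : ℝ} (ht : t ≤ 0) : psiFun t = 0 := if_pos ht

lemma psiFun_of_mem {t : ℝ} (h0 : 0 < t) (h1 : t ≤ 1) : psiFun t = 1 / (1 - Real.log t) := by
  rcases h1.lt_or_eq with h | rfl
  · rw [psiFun, if_neg (not_le.2 h0), if_pos h, log_e_div h0]
  · simp [psiFun]

lemma psiFun_of_one_le {t : ℝ} (ht : 1 ≤ t) : psiFun t = t := by
  rw [psiFun, if_neg (by linarith), if_neg (by linarith)]

lemma psiFun_nonneg (t : ℝ) : 0 ≤ psiFun t := by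
  rcases le_or_gt t 0 with h | h
  · rw [psiFun_of_nonpos h]
  rcases le_or_gt t 1 with h1 | h1
  · rw [psiFun_of_mem h h1]
    have := Real.log_nonpos h.le h1
    exact div_nonneg zero_le_one (by linarith)
  · rw [psiFun_of_one_le h1.le]
    exact h.le

lemma psiFun_monotone : Monotone psiFun := by
  intro a b hab
  rcases le_or_gt a 0 with ha | ha
  · rw [psiFun_of_nonpos ha]
    exact psiFun_nonneg b
  rcases le_or_gt b 1 with hb | hb
  · rw [psiFun_of_mem ha (hab.trans hb), psiFun_of_mem (ha.trans_le hab) hb]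
    have h1 := Real.log_nonpos (ha.trans_le hab).le hb
    have h2 := Real.log_le_log ha hab
    exact one_div_le_one_div_of_le (by linarith) (by linarith)
  · rw [psiFun_of_one_le hb.le]
    rcases le_or_gt a 1 with h | h
    · rw [psiFun_of_mem ha h]
      have h1 := Real.log_nonpos ha.le h
      have : 1 / (1 - Real.log a) ≤ 1 := by
        rw [div_le_one (by linarith)]
        linarith
      linarith
    · rw [psiFun_of_one_le h.le]
      exact hab

lemma psiFun_right_continuous (x : ℝ) : ContinuousWithinAt psiFun (Ici x) x := by
  rcases lt_trichotomy x 0 with hx | rfl | hx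
  · refine ContinuousAt.continuousWithinAt ?_
    refine (continuousAt_const (y := (0 : ℝ))).congr ?_
    filter_upwards [Iio_mem_nhds hx] with t ht
    exact (psiFun_of_nonpos (le_of_lt ht)).symm
  · rw [← continuousWithinAt_Ioi_iff_Ici, ContinuousWithinAt, psiFun_of_nonpos le_rfl]
    have h1 : Tendsto (fun t : ℝ => 1 - Real.log t) (𝓝[>] 0) atTop := by
      simpa [sub_eq_add_neg] using
        tendsto_atTop_add_const_left _ (1 : ℝ)
          (tendsto_neg_atBot_atTop.comp Real.tendsto_log_nhdsGT_zero)
    refine h1.inv_tendsto_atTop.congr' ?_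
    filter_upwards [Ioo_mem_nhdsGT (zero_lt_one' ℝ)] with t ht
    rw [psiFun_of_mem ht.1 ht.2.le, one_div]
    rfl
  · rcases lt_or_ge x 1 with h | h
    · refine ContinuousAt.continuousWithinAt ?_
      have hl := Real.log_nonpos hx.le h.le
      have hc : ContinuousAt (fun t : ℝ => 1 / (1 - Real.log t)) x :=
        continuousAt_const.div (continuousAt_const.sub (Real.continuousAt_log hx.ne'))
          (by linarith)
      refine hc.congr ?_
      filter_upwards [Ioo_mem_nhds hx h] with t ht
      exact (psiFun_of_mem ht.1 ht.2.le).symm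
    · exact continuousWithinAt_id.congr (fun t ht => psiFun_of_one_le (h.trans ht))
        (psiFun_of_one_le h)

/-- The weight `ψ` packaged for Lebesgue–Stieltjes integration. -/
def psi : StieltjesFunction ℝ where
  toFun := psiFun
  mono' := psiFun_monotone
  right_continuous' := psiFun_right_continuous

end Weight

section Bessel

variable {d : ℕ}

/-- The symbol `(1 + 4π²|ξ|²)^{-α}` of `(1 - Δ)^{-α}`, for the Fourier transform
`𝓕 u(ξ) = ∫ exp(-2πi⟨x, ξ⟩) u(x) dx`. -/
def besselSymbol (α : ℝ≥0) (ξ : EuclideanSpace ℝ (Fin d)) : ℝ :=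
  (1 + 4 * Real.pi ^ 2 * ‖ξ‖ ^ 2) ^ (-(α : ℝ))

lemma continuous_besselSymbol (α : ℝ≥0) : Continuous (besselSymbol (d := d) α) := by
  unfold besselSymbol
  refine Continuous.rpow_const (by fun_prop) (fun ξ => Or.inl ?_)
  positivity

lemma norm_besselSymbol_le (α : ℝ≥0) (ξ : EuclideanSpace ℝ (Fin d)) :
    ‖(besselSymbol α ξ : ℂ)‖ ≤ 1 := by
  have h : (1 : ℝ) ≤ 1 + 4 * Real.pi ^ 2 * ‖ξ‖ ^ 2 := le_add_of_nonneg_right (by positivity)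
  rw [Complex.norm_real, besselSymbol, Real.norm_of_nonneg (Real.rpow_nonneg (by linarith) _)]
  exact Real.rpow_le_one_of_one_le_of_nonpos h (by simp)

lemma memLp_besselSymbol_mul (α : ℝ≥0)
    (g : Lp ℂ 2 (volume : Measure (EuclideanSpace ℝ (Fin d)))) :
    MemLp (fun ξ => (besselSymbol α ξ : ℂ) * g ξ) 2 volume := by
  refine (Lp.memLp g).of_le ?_ (Eventually.of_forall fun ξ => ?_)
  · exact (Complex.continuous_ofReal.comp
      (continuous_besselSymbol α)).aestronglyMeasurable.mul (Lp.aestronglyMeasurable g)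
  · rw [norm_mul]
    exact mul_le_of_le_one_left (norm_nonneg _) (norm_besselSymbol_le α ξ)

/-- The operator `(1 - Δ)^{-α}`, `α ≥ 0`, on `L₂(ℝ^d)`: multiplication by
`(1 + 4π²|ξ|²)^{-α}` on the Fourier side (`𝓕` is the unitary Fourier transform of `L₂`). -/
def oneSubLaplacianNegPow (α : ℝ≥0)
    (x : Lp ℂ 2 (volume : Measure (EuclideanSpace ℝ (Fin d)))) :
    Lp ℂ 2 (volume : Measure (EuclideanSpace ℝ (Fin d))) :=
  𝓕⁻ ((memLp_besselSymbol_mul α (𝓕 x)).toLp _)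

end Bessel

end CriticalSobolev

end

/-!
The embedding is proved on the Fourier side, without the kernel of `(1 - Δ)^{-d/4}`. Let `g = 𝓕 x`
and cut frequency space into the shells `exp (k - 1) ≤ |ξ| < exp k`, with `a k` the `L_2` norm of
`g` on the shell `k`. The order `d / 4` is critical: on a shell, the decay of the symbol exactly
compensates the square root of the volume, so by Cauchy-Schwarz the piece of `u = (1 - Δ)^{-d/4} x`
with frequencies in the shell `k` is bounded in `L_∞` by a constant times `a k`
(`setLIntegral_freqShell_besselSymbol_le`).

At the point `s = exp (-(N + 1) d)` the frequencies below `exp N` therefore contribute at most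
a constant times `∑ k ≤ N, a k` to the rearrangement of `u`, while those above `exp N` have `L_2`
norm at most `exp (-N d / 2) ‖x‖` and contribute `O(‖x‖)` by Chebyshev's inequality
(`rearrangement_oneSubLaplacianNegPow_le`).

Since `ψ (exp (-r)) = 1 / (1 + r)`, the measure `dψ` gives the interval
`(exp (-(N + 1) d), exp (-N d)]` a mass at most `1 / (N + 1)²` (`lorentzNorm_psi_le`). The part
of the Lorentz functional on `(0, 1]` is thus at most a constant times
`∑ N, ((∑ k ≤ N, a k) / (N + 1))² + ‖x‖² ∑ N, 1 / (N + 1)²`, and Hardy's inequality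
(`tsum_sq_average_le`) bounds the first sum by `4 ∑ k, a k ^ 2 ≤ 4 ‖x‖²`. On `(1, ∞)` the measure
`dψ` is Lebesgue measure, and the Lorentz functional of `|u|²` is at most `‖u‖² ≤ ‖x‖²`.
-/

/-! ### Decreasing rearrangements -/

namespace CriticalSobolev

lemma ennreal_add_sq_le (a b : ℝ≥0∞) : (a + b) ^ 2 ≤ 2 * a ^ 2 + 2 * b ^ 2 := by
  induction a with
  | top => simp
  | coe a =>
    induction b with
    | top => simp
    | coe b =>
      rw [← mul_add]
      exact_mod_cast add_sq_le (a := a) (b := b)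

lemma measure_lintegral_div_lt_le {Ω : Type*} [MeasurableSpace Ω] {ν : Measure Ω} {F : Ω → ℝ≥0∞}
    (hF : AEMeasurable F ν) {t : ℝ≥0∞} (ht0 : t ≠ 0) (ht : t ≠ ∞) :
    ν {x | (∫⁻ y, F y ∂ν) / t < F x} ≤ t := by
  rcases eq_or_ne (∫⁻ y, F y ∂ν) 0 with h0 | h0
  · have hz := (lintegral_eq_zero_iff' hF).1 h0
    rw [h0, ENNReal.zero_div]
    refine le_trans (le_of_eq ?_) (zero_le (a := t))
    refine measure_mono_null (fun x hx => ?_) (ae_iff.1 hz)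
    exact (ne_of_gt hx : F x ≠ 0)
  rcases eq_or_ne (∫⁻ y, F y ∂ν) ∞ with h1 | h1
  · simp [h1, ENNReal.top_div_of_ne_top ht]
  · calc ν {x | (∫⁻ y, F y ∂ν) / t < F x}
        ≤ ν {x | (∫⁻ y, F y ∂ν) / t ≤ F x} := by
          refine measure_mono fun x hx => ?_
          change (∫⁻ y, F y ∂ν) / t < F x at hx
          exact hx.le
      _ ≤ (∫⁻ y, F y ∂ν) / ((∫⁻ y, F y ∂ν) / t) :=
          meas_ge_le_lintegral_div hF (ENNReal.div_ne_zero.2 ⟨h0, ht⟩) (ENNReal.div_ne_top h1 ht0)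
      _ = t := ENNReal.div_div_cancel h0 h1

variable {Ω E : Type*} [MeasurableSpace Ω] [NormedAddCommGroup E] {ν : Measure Ω} {f : Ω → E}

lemma rearrangement_le {s : ℝ} {r : ℝ≥0∞} (h : ν {x | r < ‖f x‖ₑ} ≤ ENNReal.ofReal s) :
    rearrangement ν f s ≤ r := sInf_le h

lemma rearrangement_antitone (ν : Measure Ω) (f : Ω → E) : Antitone (rearrangement ν f) :=
  fun _ _ hst => sInf_le_sInf fun _ hr => le_trans hr (ENNReal.ofReal_le_ofReal hst)

lemma rearrangement_le_lintegral_div (hf : AEStronglyMeasurable f ν) {s : ℝ} (hs : 0 < s) :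
    rearrangement ν f s ≤ (∫⁻ x, ‖f x‖ₑ ∂ν) / ENNReal.ofReal s :=
  rearrangement_le <| measure_lintegral_div_lt_le hf.enorm (by simpa using hs) ENNReal.ofReal_ne_top

/-- The rearrangement has at most the mass of the function: its superlevel set at height `t` is
contained in an interval whose length is the distribution function at `t`. -/
lemma lintegral_rearrangement_le (hf : AEStronglyMeasurable f ν) :
    ∫⁻ s in Ioi (0 : ℝ), rearrangement ν f s ≤ ∫⁻ x, ‖f x‖ₑ ∂ν := by
  rcases eq_or_ne (∫⁻ x, ‖f x‖ₑ ∂ν) ∞ with h | h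
  · rw [h]; exact le_top
  have hfin : ∀ s ∈ Ioi (0 : ℝ), rearrangement ν f s ≠ ∞ := fun s hs =>
    ne_top_of_le_ne_top (ENNReal.div_ne_top h (by simpa using hs))
      (rearrangement_le_lintegral_div hf hs)
  have hm : Measurable (rearrangement ν f) := (rearrangement_antitone ν f).measurable
  calc ∫⁻ s in Ioi (0 : ℝ), rearrangement ν f s
      = ∫⁻ s in Ioi (0 : ℝ), ENNReal.ofReal (rearrangement ν f s).toReal :=
        setLIntegral_congr_fun measurableSet_Ioi fun s hs =>
          (ENNReal.ofReal_toReal (hfin s hs)).symm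
    _ = ∫⁻ t in Ioi (0 : ℝ), volume.restrict (Ioi (0 : ℝ)) {s | t < (rearrangement ν f s).toReal} :=
        lintegral_eq_lintegral_meas_lt _ (Eventually.of_forall fun _ => ENNReal.toReal_nonneg)
          hm.ennreal_toReal.aemeasurable
    _ ≤ ∫⁻ t in Ioi (0 : ℝ), ν {x | t < ‖f x‖} := by
        refine setLIntegral_mono' measurableSet_Ioi fun t ht => ?_
        rw [Measure.restrict_apply (measurableSet_lt measurable_const hm.ennreal_toReal)]
        rcases eq_or_ne (ν {x | t < ‖f x‖}) ∞ with hi | hi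
        · rw [hi]; exact le_top
        refine (measure_mono (t := Ioo 0 (ν {x | t < ‖f x‖}).toReal) ?_).trans ?_
        · rintro s ⟨hs, hs0⟩
          change t < _ at hs
          refine ⟨hs0, lt_of_not_ge fun hle => not_le_of_gt hs ?_⟩
          refine ENNReal.toReal_le_of_le_ofReal (le_of_lt ht) (rearrangement_le ?_)
          refine (le_of_eq ?_).trans (ENNReal.ofReal_le_ofReal hle)
          rw [ENNReal.ofReal_toReal hi]
          congr 1
          ext x
          simp only [mem_ofPred_eq, ← ofReal_norm]
          exact ENNReal.ofReal_lt_ofReal_iff_of_nonneg (le_of_lt ht)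
        · rw [Real.volume_Ioo, sub_zero, ENNReal.ofReal_toReal hi]
    _ = ∫⁻ x, ENNReal.ofReal ‖f x‖ ∂ν :=
        (lintegral_eq_lintegral_meas_lt _ (Eventually.of_forall fun _ => norm_nonneg _)
          hf.norm.aemeasurable).symm
    _ = ∫⁻ x, ‖f x‖ₑ ∂ν := by simp only [ofReal_norm]

/-- The bound behind real interpolation between `L_∞` and `L_2`: a bounded summand enters the
rearrangement through its supremum, a square-integrable one through Chebyshev's inequality. -/
lemma rearrangement_sq_le_of_eq_add {u v w : Ω → E} (huvw : ∀ᵐ x ∂ν, u x = v x + w x) {M : ℝ≥0∞}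
    (hv : ∀ᵐ x ∂ν, ‖v x‖ₑ ≤ M) (hw : AEStronglyMeasurable w ν) {s : ℝ} (hs : 0 < s) :
    rearrangement ν (fun x => ‖u x‖ ^ 2) s ≤
      2 * M ^ 2 + 2 * ((∫⁻ x, ‖w x‖ₑ ^ 2 ∂ν) / ENNReal.ofReal s) := by
  refine rearrangement_le (le_trans (measure_mono_ae ?_) (measure_lintegral_div_lt_le
    (F := fun x => ‖w x‖ₑ ^ 2) (t := ENNReal.ofReal s) (hw.enorm.pow_const 2) (by simpa using hs)
    ENNReal.ofReal_ne_top))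
  filter_upwards [huvw, hv] with x hx hvx hlt
  change _ < _ at hlt
  change _ < _
  by_contra hle
  refine absurd hlt (not_lt_of_ge ?_)
  calc ‖‖u x‖ ^ 2‖ₑ = ‖u x‖ₑ ^ 2 := by rw [enorm_pow, enorm_norm]
    _ ≤ (‖v x‖ₑ + ‖w x‖ₑ) ^ 2 := by rw [hx]; gcongr; exact enorm_add_le _ _
    _ ≤ 2 * ‖v x‖ₑ ^ 2 + 2 * ‖w x‖ₑ ^ 2 := ennreal_add_sq_le _ _
    _ ≤ _ := by gcongr; exact not_lt.1 hle

lemma MemS.of_lintegral_lt_top (hf : AEStronglyMeasurable f ν) {n : ℕ}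
    (h : ∫⁻ x, ‖f x‖ₑ ^ n ∂ν < ∞) : MemS ν f := by
  refine ⟨hf, 1, lt_of_le_of_lt ?_ h⟩
  have := mul_meas_ge_le_lintegral₀ (hf.enorm.pow_const n) 1
  rw [one_mul] at this
  refine le_trans (measure_mono fun x hx => ?_) this
  have hx' : (1 : ℝ) < ‖f x‖ := by simpa using hx
  change 1 ≤ ‖f x‖ₑ ^ n
  refine one_le_pow₀ ?_
  rw [← ofReal_norm]
  exact ENNReal.one_le_ofReal.2 hx'.le

/-! ### The Lorentz functional of the logarithmic weight -/

lemma psi_measure_restrict_Ioi_one :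
    psi.measure.restrict (Ioi 1) = volume.restrict (Ioi (1 : ℝ)) := by
  refine Measure.ext_of_Ioc _ _ fun a b _ => ?_
  rw [Measure.restrict_apply measurableSet_Ioc, Measure.restrict_apply measurableSet_Ioc,
    Ioc_inter_Ioi, StieltjesFunction.measure_Ioc, Real.volume_Ioc]
  have h1 : psi (a ⊔ 1) = a ⊔ 1 := psiFun_of_one_le le_sup_right
  rw [h1]
  rcases le_total 1 b with hb | hb
  · have h2 : psi b = b := psiFun_of_one_le hb
    rw [h2]
  · have h2 : psi b ≤ 1 := (psi.mono hb).trans_eq (psiFun_of_one_le le_rfl)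
    have h3 : 1 ≤ a ⊔ 1 := le_sup_right
    rw [ENNReal.ofReal_of_nonpos (by linarith), ENNReal.ofReal_of_nonpos (by linarith)]

lemma psi_exp_neg {r : ℝ} (hr : 0 ≤ r) : psi (Real.exp (-r)) = 1 / (1 + r) := by
  change psiFun _ = _
  rw [psiFun_of_mem (Real.exp_pos _) (Real.exp_le_one_iff.2 (by linarith)), Real.log_exp,
    sub_neg_eq_add]

lemma psi_measure_Ioc_exp_le {d : ℝ} (hd : 1 ≤ d) (N : ℕ) :
    psi.measure (Ioc (Real.exp (-((N + 1) * d))) (Real.exp (-(N * d)))) ≤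
      ENNReal.ofReal (1 / ((N : ℝ) + 1) ^ 2) := by
  have hN : (0 : ℝ) ≤ N := N.cast_nonneg
  have hd0 : 0 < d := by linarith
  rw [StieltjesFunction.measure_Ioc, psi_exp_neg (by positivity), psi_exp_neg (by positivity)]
  refine ENNReal.ofReal_le_ofReal ?_
  have h1 : (1 : ℝ) / (1 + N * d) - 1 / (1 + (N + 1) * d) =
      d / ((1 + N * d) * (1 + (N + 1) * d)) := by
    field_simp
    ring
  rw [h1, div_le_div_iff₀ (by positivity) (by positivity)]
  have h2 : (N : ℝ) + 1 ≤ 1 + N * d := by nlinarith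
  have h3 : (N + 1) * d ≤ 1 + (N + 1) * d := by linarith
  have := mul_le_mul h2 h3 (by positivity) (by positivity)
  nlinarith

lemma Ioc_zero_one_subset_iUnion_exp {d : ℝ} (hd : 0 < d) :
    Ioc (0 : ℝ) 1 ⊆ ⋃ N : ℕ, Ioc (Real.exp (-((N + 1) * d))) (Real.exp (-(N * d))) := by
  rintro s ⟨hs0, hs1⟩
  have hl : 0 ≤ -Real.log s / d := div_nonneg (neg_nonneg.2 (Real.log_nonpos hs0.le hs1)) hd.le
  refine mem_iUnion.2 ⟨⌊-Real.log s / d⌋₊, ?_, ?_⟩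
  · rw [← Real.lt_log_iff_exp_lt hs0]
    have := (div_lt_iff₀ hd).1 (Nat.lt_floor_add_one (-Real.log s / d))
    linarith
  · rw [← Real.log_le_iff_le_exp hs0]
    have := (le_div_iff₀ hd).1 (Nat.floor_le hl)
    linarith

/-- A discretization of the Lorentz functional: above `s = 1` it is dominated by the `L_1` norm,
and on the exponential scale near `0` the measure `dψ` has mass `O(1 / N²)`. -/
lemma lorentzNorm_psi_le (hf : AEStronglyMeasurable f ν) {d : ℝ} (hd : 1 ≤ d) :
    lorentzNorm psi ν f ≤ ∫⁻ x, ‖f x‖ₑ ∂ν +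
      ∑' N : ℕ, rearrangement ν f (Real.exp (-((N + 1) * d))) *
        ENNReal.ofReal (1 / ((N : ℝ) + 1) ^ 2) := by
  have hsplit : Ioi (0 : ℝ) = Ioi 1 ∪ Ioc 0 1 := by
    rw [union_comm, Ioc_union_Ioi_eq_Ioi zero_le_one]
  unfold lorentzNorm
  rw [hsplit]
  refine (lintegral_union_le _ _ _).trans (add_le_add ?_ ?_)
  · rw [psi_measure_restrict_Ioi_one]
    exact (lintegral_mono_set (Ioi_subset_Ioi zero_le_one)).trans (lintegral_rearrangement_le hf)
  · refine (lintegral_mono_set (Ioc_zero_one_subset_iUnion_exp (by linarith : 0 < d))).trans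
      ((lintegral_iUnion_le _ _).trans (ENNReal.tsum_le_tsum fun N => ?_))
    refine (setLIntegral_mono' measurableSet_Ioc
      fun s hs => rearrangement_antitone ν f hs.1.le).trans ?_
    rw [setLIntegral_const]
    gcongr
    exact psi_measure_Ioc_exp_le hd N

/-! ### Hardy's inequality -/

/-- Hardy's inequality for finite sums, with the extra term that makes the induction close. -/
lemma sum_sq_average_add_le (a : ℕ → ℝ) (n : ℕ) :
    ∑ N ∈ Finset.range n, ((∑ k ∈ Finset.range (N + 1), a k) / (N + 1)) ^ 2 +
      2 * n * ((∑ k ∈ Finset.range n, a k) / n) ^ 2 ≤ 4 * ∑ k ∈ Finset.range n, a k ^ 2 := by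
  induction n with
  | zero => simp
  | succ n ih =>
    rw [Finset.sum_range_succ _ n, Finset.sum_range_succ (fun k => a k ^ 2) n]
    set S := ∑ k ∈ Finset.range n, a k with hS
    set A := (∑ k ∈ Finset.range (n + 1), a k) / ((n : ℝ) + 1) with hA
    have hn : (0 : ℝ) ≤ n := n.cast_nonneg
    have hA' : a n = (n + 1) * A - S := by
      rw [hA, Finset.sum_range_succ]
      field_simp
      ring
    have hB : S = n * (S / n) := by
      rcases eq_or_ne n 0 with rfl | h
      · simp [hS]
      · field_simp
    set B := S / (n : ℝ)
    have key : A ^ 2 + 2 * (n + 1) * A ^ 2 - 2 * n * B ^ 2 ≤ 4 * a n ^ 2 := by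
      have h0 : a n = (n + 1) * A - n * B := by rw [hA', ← hB]
      have h1 : 0 ≤ n * (A - B) ^ 2 := by positivity
      have h2 : 0 ≤ (A - 2 * a n) ^ 2 := sq_nonneg _
      have h3 : 4 * a n * A = 4 * ((n + 1) * A - n * B) * A := by rw [h0]
      nlinarith
    push_cast
    linarith

lemma tsum_sq_average_le (a : ℕ → ℝ≥0∞) :
    ∑' N : ℕ, (∑ k ∈ Finset.range (N + 1), a k) ^ 2 * ENNReal.ofReal (1 / ((N : ℝ) + 1) ^ 2) ≤
      4 * ∑' k, a k ^ 2 := by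
  by_cases htop : ∃ k, a k = ∞
  · obtain ⟨k, hk⟩ := htop
    have : ∑' k, a k ^ 2 = ∞ := ENNReal.tsum_eq_top_of_eq_top ⟨k, by simp [hk]⟩
    simp [this]
  push Not at htop
  lift a to ℕ → ℝ≥0 using htop
  refine ENNReal.tsum_le_of_sum_range_le fun n => ?_
  refine le_trans ?_ (mul_le_mul_right (ENNReal.sum_le_tsum (Finset.range n)) 4)
  have h := sum_sq_average_add_le (fun k => (a k : ℝ)) n
  have h2 : ∑ N ∈ Finset.range n, ((∑ k ∈ Finset.range (N + 1), (a k : ℝ)) / (N + 1)) ^ 2 ≤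
      4 * ∑ k ∈ Finset.range n, (a k : ℝ) ^ 2 := le_trans (le_add_of_nonneg_right (by positivity)) h
  have h3 : ∀ N : ℕ, (∑ k ∈ Finset.range (N + 1), (a k : ℝ≥0∞)) ^ 2 *
      ENNReal.ofReal (1 / ((N : ℝ) + 1) ^ 2) =
      ENNReal.ofReal (((∑ k ∈ Finset.range (N + 1), (a k : ℝ)) / (N + 1)) ^ 2) := by
    intro N
    rw [div_pow, div_eq_mul_one_div (_ ^ 2), ENNReal.ofReal_mul (by positivity),
      ENNReal.ofReal_pow (by positivity)]
    congr 2
    rw [ENNReal.ofReal_sum_of_nonneg fun _ _ => NNReal.coe_nonneg _]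
    simp
  have h4 : 4 * ∑ k ∈ Finset.range n, (a k : ℝ≥0∞) ^ 2 =
      ENNReal.ofReal (4 * ∑ k ∈ Finset.range n, (a k : ℝ) ^ 2) := by
    rw [ENNReal.ofReal_mul (by norm_num), ENNReal.ofReal_sum_of_nonneg fun _ _ => by positivity]
    simp [ENNReal.ofReal_pow]
  rw [Finset.sum_congr rfl fun N _ => h3 N, h4,
    ← ENNReal.ofReal_sum_of_nonneg fun _ _ => by positivity]
  exact ENNReal.ofReal_le_ofReal h2

end CriticalSobolev

/-! ### The inverse Fourier transform of integrable `L₂` functions -/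

namespace CriticalSobolev

variable {V : Type*} [NormedAddCommGroup V] [InnerProductSpace ℝ V] [FiniteDimensional ℝ V]
  [MeasurableSpace V] [BorelSpace V]

/-- On `L_1 ∩ L_2` the unitary inverse Fourier transform is given by the integral formula: both
sides pair in the same way with test functions. -/
lemma coeFn_fourierInv_ae_eq (h : Lp ℂ 2 (volume : Measure V)) (hi : Integrable h) :
    (𝓕⁻ h : Lp ℂ 2 (volume : Measure V)) =ᵐ[volume] 𝓕⁻ (h : V → ℂ) := by
  have hcont : Continuous (𝓕⁻ (h : V → ℂ)) :=
    VectorFourier.fourierIntegral_continuous Real.continuous_fourierChar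
      (continuous_inner (𝕜 := ℝ)).neg hi
  refine ae_eq_of_integral_contDiff_smul_eq
    ((Lp.memLp _).locallyIntegrable one_le_two) hcont.locallyIntegrable fun g hg hgs => ?_
  have hg1 : HasCompactSupport fun x => (g x : ℂ) := hgs.comp_left Complex.ofReal_zero
  have hg2 : ContDiff ℝ (⊤ : ℕ∞) fun x => (g x : ℂ) := Complex.ofRealCLM.contDiff.comp hg
  set φ := hg1.toSchwartzMap hg2 with hφ
  have hφa : ∀ x, φ x = (g x : ℂ) := fun x => rfl
  have h1 := congrArg (fun T => T φ) (Lp.fourierInv_toTemperedDistribution_eq h)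
  simp only [TemperedDistribution.fourierInv_apply, Lp.toTemperedDistribution_apply] at h1
  have h2 := VectorFourier.integral_fourierIntegral_smul_eq_flip (μ := (volume : Measure V))
    (ν := (volume : Measure V)) (L := -innerₗ V) (f := φ) (g := h)
    Real.continuous_fourierChar (continuous_inner (𝕜 := ℝ)).neg φ.integrable hi
  have hflip : (-innerₗ V).flip = -innerₗ V := by
    ext x y
    simp [real_inner_comm]
  rw [hflip] at h2
  have h3 : ∀ ξ, (𝓕⁻ φ) ξ = VectorFourier.fourierIntegral 𝐞 volume (-innerₗ V) φ ξ := fun ξ => by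
    rw [SchwartzMap.fourierInv_coe]; rfl
  simp only [h3] at h1
  have h4 := h1.symm.trans h2
  simp only [hφa] at h4
  exact h4

lemma enorm_fourierInv_le_lintegral (h : Lp ℂ 2 (volume : Measure V))
    (hi : ∫⁻ ξ, ‖h ξ‖ₑ ≠ ∞) :
    ∀ᵐ x, ‖(𝓕⁻ h : Lp ℂ 2 (volume : Measure V)) x‖ₑ ≤ ∫⁻ ξ, ‖h ξ‖ₑ := by
  have hint : Integrable h := ⟨Lp.aestronglyMeasurable h, lt_top_iff_ne_top.2 hi⟩
  filter_upwards [coeFn_fourierInv_ae_eq h hint] with x hx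
  rw [hx, ← ofReal_norm, ← ofReal_integral_norm_eq_lintegral_enorm hint]
  exact ENNReal.ofReal_le_ofReal (VectorFourier.norm_fourierIntegral_le_integral_norm _ _ _ _ _)

lemma Lp_two_enorm_sq {Ω : Type*} [MeasurableSpace Ω] {ν : Measure Ω} (f : Lp ℂ 2 ν) :
    ‖f‖ₑ ^ 2 = ∫⁻ x, ‖f x‖ₑ ^ 2 ∂ν := by
  rw [Lp.enorm_def]
  have := eLpNorm_nnreal_pow_eq_lintegral (μ := ν) (f := f) (p := 2) two_ne_zero
  simpa using this

lemma enorm_fourier (f : Lp ℂ 2 (volume : Measure V)) : ‖𝓕 f‖ₑ = ‖f‖ₑ := by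
  rw [← ofReal_norm, Lp.norm_fourier_eq, ofReal_norm]

lemma enorm_fourierInv (f : Lp ℂ 2 (volume : Measure V)) :
    ‖(𝓕⁻ f : Lp ℂ 2 (volume : Measure V))‖ₑ = ‖f‖ₑ := by
  rw [← enorm_fourier (𝓕⁻ f), FourierTransform.fourier_fourierInv_eq]

end CriticalSobolev

/-! ### Frequency decomposition -/

namespace CriticalSobolev

variable {d : ℕ}

lemma besselSymbol_nonneg (α : ℝ≥0) (ξ : EuclideanSpace ℝ (Fin d)) : 0 ≤ besselSymbol α ξ := by
  unfold besselSymbol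
  positivity

lemma besselSymbol_le_exp {ξ : EuclideanSpace ℝ (Fin d)} {r : ℝ}
    (h : Real.exp (2 * r) ≤ 1 + ‖ξ‖ ^ 2) :
    besselSymbol ((d : ℝ≥0) / 4) ξ ≤ Real.exp (-(r * d / 2)) := by
  have hpi : (1 : ℝ) ≤ 4 * Real.pi ^ 2 := by nlinarith [Real.pi_gt_three]
  have h1 : Real.exp (2 * r) ≤ 1 + 4 * Real.pi ^ 2 * ‖ξ‖ ^ 2 :=
    h.trans (by nlinarith [sq_nonneg ‖ξ‖])
  calc besselSymbol ((d : ℝ≥0) / 4) ξ ≤ (Real.exp (2 * r)) ^ (-(((d : ℝ≥0) / 4 : ℝ≥0) : ℝ)) :=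
        Real.rpow_le_rpow_of_nonpos (Real.exp_pos _) h1
          (neg_nonpos.2 (NNReal.coe_nonneg _))
    _ = Real.exp (-(r * d / 2)) := by
        rw [← Real.exp_mul]
        congr 1
        push_cast
        ring

/-- The ball of radius `exp n` in frequency space. -/
def freqBall (d n : ℕ) : Set (EuclideanSpace ℝ (Fin d)) := Metric.ball 0 (Real.exp n)

/-- The exponential shells: the unit ball `|ξ| < 1` for `n = 0`, and
`exp (n - 1) ≤ |ξ| < exp n` for `n ≥ 1`. -/
def freqShell (d : ℕ) : ℕ → Set (EuclideanSpace ℝ (Fin d)) := disjointed (freqBall d)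

lemma measurableSet_freqBall (n : ℕ) : MeasurableSet (freqBall d n) :=
  Metric.isOpen_ball.measurableSet

lemma measurableSet_freqShell (n : ℕ) : MeasurableSet (freqShell d n) :=
  MeasurableSet.disjointed measurableSet_freqBall n

lemma freqBall_mono : Monotone (freqBall d) := fun _ _ hmn =>
  Metric.ball_subset_ball (Real.exp_le_exp.2 (Nat.cast_le.2 hmn))

lemma exp_le_of_mem_freqShell {n : ℕ} {ξ : EuclideanSpace ℝ (Fin d)} (hξ : ξ ∈ freqShell d n) :
    Real.exp (2 * ((n : ℝ) - 1)) ≤ 1 + ‖ξ‖ ^ 2 := by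
  cases n with
  | zero =>
    have : Real.exp (2 * (((0 : ℕ) : ℝ) - 1)) ≤ 1 := Real.exp_le_one_iff.2 (by norm_num)
    nlinarith [sq_nonneg ‖ξ‖]
  | succ n =>
    rw [freqShell, freqBall_mono.disjointed_add_one] at hξ
    have h : Real.exp n ≤ ‖ξ‖ := by simpa [freqBall] using hξ.2
    have h2 : Real.exp (2 * (((n + 1 : ℕ) : ℝ) - 1)) = Real.exp n ^ 2 := by
      rw [← Real.exp_nat_mul]
      congr 1
      push_cast
      ring
    rw [h2]
    have := pow_le_pow_left₀ (Real.exp_pos _).le h 2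
    linarith

lemma setLIntegral_freqBall_le (F : EuclideanSpace ℝ (Fin d) → ℝ≥0∞) (N : ℕ) :
    ∫⁻ ξ in freqBall d N, F ξ ≤ ∑ k ∈ Finset.range (N + 1), ∫⁻ ξ in freqShell d k, F ξ := by
  induction N with
  | zero => simp [freqShell]
  | succ N ih =>
    rw [Finset.sum_range_succ]
    refine le_trans ?_ (add_le_add_left ih _)
    rw [← freqBall_mono.disjointed_add_one_sup N, sup_comm]
    exact lintegral_union_le _ _ _

lemma volume_freqBall (hd : 0 < d) (n : ℕ) :
    volume (freqBall d n) = ENNReal.ofReal (Real.exp (n * d)) *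
      volume (Metric.ball (0 : EuclideanSpace ℝ (Fin d)) 1) := by
  have : Nonempty (Fin d) := ⟨⟨0, hd⟩⟩
  rw [freqBall, Measure.addHaar_ball _ _ (Real.exp_pos _).le, finrank_euclideanSpace_fin,
    ← Real.exp_nat_mul, mul_comm (d : ℝ)]

/-- The `L_2` norm of `g` on the shell of index `n`. -/
noncomputable def shellNorm (g : EuclideanSpace ℝ (Fin d) → ℂ) (n : ℕ) : ℝ≥0∞ :=
  (∫⁻ ξ in freqShell d n, ‖g ξ‖ₑ ^ 2) ^ (1 / 2 : ℝ)

lemma ennreal_sq_rpow_half (a : ℝ≥0∞) : (a ^ (1 / 2 : ℝ)) ^ 2 = a := by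
  rw [← ENNReal.rpow_natCast, ← ENNReal.rpow_mul]
  norm_num

lemma ennreal_rpow_half_sq (a : ℝ≥0∞) : (a ^ 2) ^ (1 / 2 : ℝ) = a := by
  rw [← ENNReal.rpow_natCast, ← ENNReal.rpow_mul]
  norm_num

lemma tsum_shellNorm_sq_le (g : EuclideanSpace ℝ (Fin d) → ℂ) :
    ∑' n, shellNorm g n ^ 2 ≤ ∫⁻ ξ, ‖g ξ‖ₑ ^ 2 := by
  simp only [shellNorm, ennreal_sq_rpow_half]
  rw [← lintegral_iUnion measurableSet_freqShell (disjoint_disjointed _)]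
  exact setLIntegral_le_lintegral _ _

/-- At the critical order `d / 4` the decay of the symbol on a shell exactly balances the volume of
the shell in the Cauchy-Schwarz inequality, so the constant does not depend on the shell. -/
lemma setLIntegral_freqShell_besselSymbol_le (hd : 0 < d) {g : EuclideanSpace ℝ (Fin d) → ℂ}
    (hg : AEStronglyMeasurable g) (n : ℕ) :
    ∫⁻ ξ in freqShell d n, ‖(besselSymbol ((d : ℝ≥0) / 4) ξ : ℂ) * g ξ‖ₑ ≤
      (ENNReal.ofReal (Real.exp d) * volume (Metric.ball (0 : EuclideanSpace ℝ (Fin d)) 1)) ^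
        (1 / 2 : ℝ) * shellNorm g n := by
  set ω := volume (Metric.ball (0 : EuclideanSpace ℝ (Fin d)) 1)
  have hbound : ∀ ξ ∈ freqShell d n, ‖(besselSymbol ((d : ℝ≥0) / 4) ξ : ℂ) * g ξ‖ₑ ≤
      ENNReal.ofReal (Real.exp (-(((n : ℝ) - 1) * d / 2))) * ‖g ξ‖ₑ := fun ξ hξ => by
    rw [enorm_mul, ← ofReal_norm, Complex.norm_real, Real.norm_of_nonneg (besselSymbol_nonneg _ _)]
    gcongr
    exact besselSymbol_le_exp (exp_le_of_mem_freqShell hξ)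
  have hCS : ∫⁻ ξ in freqShell d n, ‖g ξ‖ₑ ≤
      shellNorm g n * (volume (freqShell d n)) ^ (1 / 2 : ℝ) := by
    have h := ENNReal.lintegral_mul_norm_pow_le (μ := volume.restrict (freqShell d n))
      (f := fun ξ => ‖g ξ‖ₑ ^ 2) (g := fun _ => 1) (hg.enorm.restrict.pow_const 2)
      aemeasurable_const (p := 1 / 2) (q := 1 / 2) (by norm_num) (by norm_num) (by norm_num)
    simpa only [ennreal_rpow_half_sq, shellNorm, ENNReal.one_rpow, mul_one, lintegral_one,
      Measure.restrict_apply_univ] using h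
  have hvol : volume (freqShell d n) ≤ ENNReal.ofReal (Real.exp (n * d)) * ω :=
    (measure_mono (disjointed_subset _ _)).trans_eq (volume_freqBall hd n)
  calc ∫⁻ ξ in freqShell d n, ‖(besselSymbol ((d : ℝ≥0) / 4) ξ : ℂ) * g ξ‖ₑ
      ≤ ∫⁻ ξ in freqShell d n, ENNReal.ofReal (Real.exp (-(((n : ℝ) - 1) * d / 2))) * ‖g ξ‖ₑ :=
        setLIntegral_mono' (measurableSet_freqShell n) hbound
    _ = ENNReal.ofReal (Real.exp (-(((n : ℝ) - 1) * d / 2))) * ∫⁻ ξ in freqShell d n, ‖g ξ‖ₑ :=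
        lintegral_const_mul' _ _ ENNReal.ofReal_ne_top
    _ ≤ ENNReal.ofReal (Real.exp (-(((n : ℝ) - 1) * d / 2))) *
          (shellNorm g n * (ENNReal.ofReal (Real.exp (n * d)) * ω) ^ (1 / 2 : ℝ)) := by
        gcongr
        exact hCS.trans (by gcongr)
    _ = (ENNReal.ofReal (Real.exp d) * ω) ^ (1 / 2 : ℝ) * shellNorm g n := by
        rw [ENNReal.mul_rpow_of_nonneg _ _ (by norm_num),
          ENNReal.mul_rpow_of_nonneg _ _ (by norm_num),
          ENNReal.ofReal_rpow_of_pos (Real.exp_pos _), ENNReal.ofReal_rpow_of_pos (Real.exp_pos _),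
          ← Real.exp_mul, ← Real.exp_mul]
        have h : Real.exp (d * (1 / 2)) =
            Real.exp (-(((n : ℝ) - 1) * d / 2)) * Real.exp (n * d * (1 / 2)) := by
          rw [← Real.exp_add]
          congr 1
          ring
        rw [h, ENNReal.ofReal_mul (Real.exp_pos _).le]
        ring

/-- The rearrangement of `(1 - Δ)^{-d/4} x` on the exponential scale. Frequencies below `exp N` are
estimated in `L_∞` shell by shell, those above `exp N` in `L_2`. -/
lemma rearrangement_oneSubLaplacianNegPow_le (hd : 0 < d)
    (x : Lp ℂ 2 (volume : Measure (EuclideanSpace ℝ (Fin d)))) (N : ℕ) :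
    rearrangement volume (fun y => ‖oneSubLaplacianNegPow ((d : ℝ≥0) / 4) x y‖ ^ 2)
        (Real.exp (-((N + 1) * d))) ≤
      2 * (ENNReal.ofReal (Real.exp d) * volume (Metric.ball (0 : EuclideanSpace ℝ (Fin d)) 1)) *
        (∑ k ∈ Finset.range (N + 1), shellNorm (𝓕 x : Lp ℂ 2 volume) k) ^ 2 +
      2 * ENNReal.ofReal (Real.exp d) * ‖x‖ₑ ^ 2 := by
  set K := ENNReal.ofReal (Real.exp d) * volume (Metric.ball (0 : EuclideanSpace ℝ (Fin d)) 1)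
    with hK
  set g : Lp ℂ 2 (volume : Measure (EuclideanSpace ℝ (Fin d))) := 𝓕 x with hg
  set S := ∑ k ∈ Finset.range (N + 1), shellNorm g k with hS
  have hmem := memLp_besselSymbol_mul ((d : ℝ≥0) / 4) g
  have hB := measurableSet_freqBall (d := d) N
  set lo := (hmem.indicator hB).toLp _ with hlo
  set hi := (hmem.indicator hB.compl).toLp _ with hhi
  have hsum : oneSubLaplacianNegPow ((d : ℝ≥0) / 4) x = 𝓕⁻ lo + 𝓕⁻ hi := by
    rw [← FourierTransform.fourierInv_add, hlo, hhi, ← MemLp.toLp_add]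
    unfold oneSubLaplacianNegPow
    congr 2
    exact (indicator_self_add_compl _ _).symm
  have hlo_le : ∫⁻ ξ, ‖lo ξ‖ₑ ≤ K ^ (1 / 2 : ℝ) * S := by
    calc ∫⁻ ξ, ‖lo ξ‖ₑ
        = ∫⁻ ξ, (freqBall d N).indicator
            (fun ξ => ‖(besselSymbol ((d : ℝ≥0) / 4) ξ : ℂ) * g ξ‖ₑ) ξ := by
          refine lintegral_congr_ae ?_
          filter_upwards [(hmem.indicator hB).coeFn_toLp] with ξ hξ
          rw [hξ, enorm_indicator_eq_indicator_enorm]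
      _ = ∫⁻ ξ in freqBall d N, ‖(besselSymbol ((d : ℝ≥0) / 4) ξ : ℂ) * g ξ‖ₑ :=
          lintegral_indicator hB _
      _ ≤ ∑ k ∈ Finset.range (N + 1), K ^ (1 / 2 : ℝ) * shellNorm g k :=
          (setLIntegral_freqBall_le _ N).trans (Finset.sum_le_sum fun k _ =>
            setLIntegral_freqShell_besselSymbol_le hd (Lp.aestronglyMeasurable g) k)
      _ = K ^ (1 / 2 : ℝ) * S := by rw [← Finset.mul_sum]
  have hg2 : ‖g‖ₑ = ‖x‖ₑ := enorm_fourier x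
  have hK_top : K ≠ ∞ := ENNReal.mul_ne_top ENNReal.ofReal_ne_top measure_ball_lt_top.ne
  have hS_top : S ≠ ∞ := by
    refine (ENNReal.sum_lt_top.2 fun k _ => ?_).ne
    refine ENNReal.rpow_lt_top_of_nonneg (by norm_num) ?_
    refine ne_top_of_le_ne_top ?_ (setLIntegral_le_lintegral _ _)
    rw [← Lp_two_enorm_sq]
    simp
  have hlo_top : ∫⁻ ξ, ‖lo ξ‖ₑ ≠ ∞ := ne_top_of_le_ne_top
    (ENNReal.mul_ne_top (ENNReal.rpow_ne_top_of_nonneg (by norm_num) hK_top) hS_top) hlo_le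
  have hhi_le : ‖hi‖ ≤ Real.exp (-(N * d / 2)) * ‖g‖ := by
    refine Lp.norm_le_mul_norm_of_ae_le_mul ?_
    filter_upwards [(hmem.indicator hB.compl).coeFn_toLp] with ξ hξ
    rw [hξ]
    by_cases hmemξ : ξ ∈ (freqBall d N)ᶜ
    · rw [indicator_of_mem hmemξ, norm_mul, Complex.norm_real,
        Real.norm_of_nonneg (besselSymbol_nonneg _ _)]
      gcongr
      refine besselSymbol_le_exp ?_
      have h1 : Real.exp N ≤ ‖ξ‖ := by simpa [freqBall] using hmemξ
      have h2 : Real.exp (2 * N) = Real.exp N ^ 2 := by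
        rw [← Real.exp_nat_mul]
        norm_num
      have := pow_le_pow_left₀ (Real.exp_pos _).le h1 2
      linarith
    · rw [indicator_of_notMem hmemξ, norm_zero]
      positivity
  have hhi_sq : ∫⁻ y, ‖(𝓕⁻ hi : Lp ℂ 2 volume) y‖ₑ ^ 2 ≤
      ENNReal.ofReal (Real.exp (-(N * d))) * ‖x‖ₑ ^ 2 := by
    rw [← Lp_two_enorm_sq, enorm_fourierInv, ← hg2]
    calc ‖hi‖ₑ ^ 2 ≤ (ENNReal.ofReal (Real.exp (-(N * d / 2))) * ‖g‖ₑ) ^ 2 := by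
          gcongr
          rw [← ofReal_norm, ← ofReal_norm, ← ENNReal.ofReal_mul (Real.exp_pos _).le]
          exact ENNReal.ofReal_le_ofReal hhi_le
      _ = _ := by
          rw [mul_pow, ← ENNReal.ofReal_pow (Real.exp_pos _).le, ← Real.exp_nat_mul]
          congr 3
          push_cast
          ring
  refine (rearrangement_sq_le_of_eq_add (v := (𝓕⁻ lo : Lp ℂ 2 volume))
    (w := (𝓕⁻ hi : Lp ℂ 2 volume)) (M := K ^ (1 / 2 : ℝ) * S) ?_ ?_
    (Lp.aestronglyMeasurable _) (Real.exp_pos _)).trans ?_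
  · rw [hsum]
    exact Lp.coeFn_add _ _
  · filter_upwards [enorm_fourierInv_le_lintegral lo hlo_top] with y hy
    exact hy.trans hlo_le
  · rw [mul_pow, ennreal_sq_rpow_half, mul_assoc 2 K, mul_assoc 2 (ENNReal.ofReal _)]
    gcongr
    refine ENNReal.div_le_of_le_mul (hhi_sq.trans_eq ?_)
    have h : Real.exp (-(N * d)) = Real.exp d * Real.exp (-((N + 1) * d)) := by
      rw [← Real.exp_add]
      congr 1
      ring
    rw [h, ENNReal.ofReal_mul (Real.exp_pos _).le]
    ring

lemma enorm_oneSubLaplacianNegPow_le (α : ℝ≥0)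
    (x : Lp ℂ 2 (volume : Measure (EuclideanSpace ℝ (Fin d)))) :
    ‖oneSubLaplacianNegPow α x‖ₑ ≤ ‖x‖ₑ := by
  rw [oneSubLaplacianNegPow, enorm_fourierInv, ← enorm_fourier x, ← ofReal_norm, ← ofReal_norm]
  refine ENNReal.ofReal_le_ofReal ?_
  rw [← one_mul ‖(𝓕 x : Lp ℂ 2 volume)‖]
  refine Lp.norm_le_mul_norm_of_ae_le_mul ?_
  filter_upwards [(memLp_besselSymbol_mul α (𝓕 x)).coeFn_toLp] with ξ hξ
  rw [hξ, norm_mul]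
  gcongr
  exact norm_besselSymbol_le α ξ

/-- The constant in the critical embedding for the squared functional: `1` from the `L_2` norm
above `s = 1`, the next term from Hardy's inequality, the last from the high frequencies. -/
noncomputable def embeddingConst (d : ℕ) : ℝ≥0∞ :=
  1 + 2 * (ENNReal.ofReal (Real.exp d) * volume (Metric.ball (0 : EuclideanSpace ℝ (Fin d)) 1)) *
      4 +
    2 * ENNReal.ofReal (Real.exp d) * ∑' N : ℕ, ENNReal.ofReal (1 / ((N : ℝ) + 1) ^ 2)

lemma embeddingConst_ne_top (d : ℕ) : embeddingConst d ≠ ∞ := by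
  have hs : Summable fun N : ℕ => 1 / ((N : ℝ) + 1) ^ 2 := by
    have := (summable_nat_add_iff 1).2 (Real.summable_one_div_nat_pow.2 one_lt_two)
    simpa using this
  have h1 : ∑' N : ℕ, ENNReal.ofReal (1 / ((N : ℝ) + 1) ^ 2) ≠ ∞ := hs.tsum_ofReal_ne_top
  have h2 : volume (Metric.ball (0 : EuclideanSpace ℝ (Fin d)) 1) ≠ ∞ := measure_ball_lt_top.ne
  unfold embeddingConst
  finiteness

lemma lorentzNorm_sq_oneSubLaplacianNegPow_le (hd : 0 < d)
    (x : Lp ℂ 2 (volume : Measure (EuclideanSpace ℝ (Fin d)))) :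
    lorentzNorm psi volume (fun y => ‖oneSubLaplacianNegPow ((d : ℝ≥0) / 4) x y‖ ^ 2) ≤
      embeddingConst d * ‖x‖ₑ ^ 2 := by
  set u := oneSubLaplacianNegPow ((d : ℝ≥0) / 4) x with hu
  set G : Lp ℂ 2 (volume : Measure (EuclideanSpace ℝ (Fin d))) := 𝓕 x with hG
  have hm : AEStronglyMeasurable (fun y => ‖u y‖ ^ 2) volume :=
    (Lp.aestronglyMeasurable u).norm.pow 2
  have hL1 : ∫⁻ y, ‖‖u y‖ ^ 2‖ₑ ≤ ‖x‖ₑ ^ 2 := by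
    simp only [enorm_pow, enorm_norm]
    rw [← Lp_two_enorm_sq]
    gcongr
    exact enorm_oneSubLaplacianNegPow_le _ x
  have hHardy : ∑' N : ℕ, (∑ k ∈ Finset.range (N + 1), shellNorm G k) ^ 2 *
      ENNReal.ofReal (1 / ((N : ℝ) + 1) ^ 2) ≤ 4 * ‖x‖ₑ ^ 2 := by
    refine (tsum_sq_average_le _).trans ?_
    gcongr
    refine (tsum_shellNorm_sq_le _).trans_eq ?_
    rw [← Lp_two_enorm_sq, hG, enorm_fourier]
  refine (lorentzNorm_psi_le hm (Nat.one_le_cast.2 hd)).trans ?_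
  set K := ENNReal.ofReal (Real.exp d) * volume (Metric.ball (0 : EuclideanSpace ℝ (Fin d)) 1)
    with hK
  set D := 2 * ENNReal.ofReal (Real.exp d) with hD
  calc _ ≤ ‖x‖ₑ ^ 2 + ∑' N : ℕ,
        (2 * K * ((∑ k ∈ Finset.range (N + 1), shellNorm G k) ^ 2 *
            ENNReal.ofReal (1 / ((N : ℝ) + 1) ^ 2)) +
          D * ‖x‖ₑ ^ 2 * ENNReal.ofReal (1 / ((N : ℝ) + 1) ^ 2)) := by
        refine add_le_add hL1 (ENNReal.tsum_le_tsum fun N => ?_)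
        rw [← mul_assoc, ← add_mul]
        gcongr
        exact rearrangement_oneSubLaplacianNegPow_le hd x N
    _ ≤ ‖x‖ₑ ^ 2 + (2 * K * (4 * ‖x‖ₑ ^ 2) +
          D * ‖x‖ₑ ^ 2 * ∑' N : ℕ, ENNReal.ofReal (1 / ((N : ℝ) + 1) ^ 2)) := by
        rw [ENNReal.tsum_add, ENNReal.tsum_mul_left, ENNReal.tsum_mul_left]
        gcongr
    _ = embeddingConst d * ‖x‖ₑ ^ 2 := by
        rw [embeddingConst, ← hK, ← hD]
        ring

end CriticalSobolev

/-- Critical Sobolev embedding: `(1 - Δ)^{-d/4}` maps `L₂(ℝ^d)` boundedly into `Λ_ψ^{(2)}(ℝ^d)`. -/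
theorem proposition5p1 (d : ℕ) (hd : 0 < d) :
    ∃ c : ℝ≥0, ∀ x : Lp ℂ 2 (volume : Measure (EuclideanSpace ℝ (Fin d))),
      CriticalSobolev.MemLorentzTwo CriticalSobolev.psi volume
        (CriticalSobolev.oneSubLaplacianNegPow ((d : ℝ≥0) / 4) x) ∧
      CriticalSobolev.lorentzTwoNorm CriticalSobolev.psi volume
        (CriticalSobolev.oneSubLaplacianNegPow ((d : ℝ≥0) / 4) x) ≤ c * ‖x‖ₑ := by
  -- The functional of the convexification is a square root, so the constant is one too.
  open CriticalSobolev in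
  refine ⟨(embeddingConst d ^ (1 / 2 : ℝ)).toNNReal, fun x => ?_⟩
  set u := oneSubLaplacianNegPow ((d : ℝ≥0) / 4) x with hu
  have hmain := lorentzNorm_sq_oneSubLaplacianNegPow_le hd x
  have hu2 : ∫⁻ y, ‖u y‖ₑ ^ 2 < ∞ := by
    rw [← Lp_two_enorm_sq]
    simp
  have hm := Lp.aestronglyMeasurable u
  refine ⟨⟨MemS.of_lintegral_lt_top hm hu2, MemS.of_lintegral_lt_top (n := 1) (hm.norm.pow 2) ?_,
    hmain.trans_lt ?_⟩, ?_⟩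
  · simpa [enorm_pow] using hu2
  · exact ENNReal.mul_lt_top (embeddingConst_ne_top d).lt_top (by simp)
  · rw [ENNReal.coe_toNNReal
      (ENNReal.rpow_ne_top_of_nonneg (by norm_num) (embeddingConst_ne_top d))]
    calc lorentzTwoNorm psi volume u ≤ (embeddingConst d * ‖x‖ₑ ^ 2) ^ (1 / 2 : ℝ) :=
          ENNReal.rpow_le_rpow hmain (by norm_num)
      _ = embeddingConst d ^ (1 / 2 : ℝ) * ‖x‖ₑ := by
          rw [ENNReal.mul_rpow_of_nonneg _ _ (by norm_num), ennreal_rpow_half_sq]
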